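/- Identify $\mathbb{R}^3$ with the imaginary quaternions, let $M$ be a Riemann surface, and let $q$ be a holomorphic quadratic differential on $M$. Surfaces are smooth immersions $M\to\mathbb{R}^3$. A conformal surface $f$ with Gauss map $n$ is *isothermic* (with curvature line net given by $q$) if around each point there is a holomorphic coordinate $w=u+iv$ with $q=dw^2$ such that $\langle df,df\rangle=E(du^2+dv^2)$ and $\langle df,dn\rangle=-E(\kappa_1du^2+\kappa_2dv^2)$. A surface $f^*$ is a *Christoffel dual* of the conformal surface $f$ if $df\,df^*=q$, where $\mathbb{C}$ is identified with the normal bundle $\mathbb{R}\oplus\mathbb{R}n$ of $f$ by $i\mapsto n$; that is, $df\,df^*=(du^2-dv^2)+2n\,du\,dv$ if $q=(du+i\,dv)^2$. (The differential $q$ fixes the scale of all Christoffel duals; $df^*$ is determined by $f$ and $q$, and $f^*$ is determined up to translation on connected $M$.) For $t\in\mathbb{R}\setminus\{0\}$, a surface $\hat f$ with $\hat f\neq f$ everywhere is a *Darboux transform* $\hat f=D_t(f)$ if $d\hat f=t(\hat f-f)\,df^*(\hat f-f)$. For a Möbius transformation $\mu(x)=(ax+b)(cx+d)^{-1}$ of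 $\mathbb{R}^3\cup\{\infty\}$ ($a,b,c,d$ quaternions), a *Goursat transform* $G_\mu(f)=(\mu\circ f^*)^*$ of $f$ is a Christoffel dual of $\mu\circ f^*$, where $f^*$ is a Christoffel dual of $f$ and $\mu\circ f^*$ takes no value $\infty$. All Christoffel duals and Darboux transforms are taken with respect to the same $q$. **Theorem.** Let $f:M\to\mathbb{R}^3$ be isothermic, let $\hat f=D_t(f)$ be a Darboux transform and let $\tilde f=G_\mu(f)=(\mu\circ f^*)^*$ be a Goursat transform of $f$. Put $\hat f^*:=f^*+\frac1t(\hat f-f)^{-1}$ and assume that $\mu\circ\hat f^*$ takes no value $\infty$. Then $$G_\mu(\hat f):=G_\mu(f)+\frac1t\left(\mu\circ\hat f^*-\mu\circ f^*\right)^{-1}$$ is at once a Goursat transform of $\hat f$ and a $D_t$-transform of $\tilde f=G_\mu(f)$. Moreover the whole diagram commutes: the eight surfaces $f,\ f^*,\ \mu\circ f^*,\ G_\mu(f)$ and $\hat f,\ \hat f^*,\ \mu\circ\hat f^*,\ G_\mu(\hat f)$ are isothermic; within each of these two lists the first two and the last two surfaces are Christoffel duals of each other, so that the fourth is the Goursat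 transform of the first obtained from the second; and $\hat f=D_t(f)$, $\hat f^*=D_t(f^*)$, $\mu\circ\hat f^*=D_t(\mu\circ f^*)$, $G_\mu(\hat f)=D_t(G_\mu(f))$. -/

import Mathlib

open scoped Quaternion Manifold ContDiff Topology

noncomputable section

namespace Isothermic

/- Euclidean 3-space is the space of imaginary quaternions. A surface is a map `f : M → ℍ[ℝ]`
with vanishing real part, where `M` is a Riemann surface (a complex 1-manifold). The tangent space
of `M` at `p` is `ℂ` (through the preferred chart at `p`), and multiplication by `Complex.I` on it
is the complex structure of `M`. -/

section Surfaces

variable {M : Type*} [TopologicalSpace M] [ChartedSpace ℂ M]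

/-- The (real) differential `df` at `p` of a quaternion valued map. -/
def diff (f : M → ℍ[ℝ]) (p : M) : ℂ →L[ℝ] ℍ[ℝ] :=
  mfderiv 𝓘(ℝ, ℂ) 𝓘(ℝ, ℍ[ℝ]) f p

/-- The (complex) differential at `p` of a complex valued map. -/
def cdiff (w : M → ℂ) (p : M) : ℂ →L[ℂ] ℂ :=
  mfderiv 𝓘(ℂ, ℂ) 𝓘(ℂ, ℂ) w p

/-- A surface in Euclidean 3-space: a smooth immersion into the imaginary quaternions. -/
structure IsSurface (f : M → ℍ[ℝ]) : Prop where
  smooth : ContMDiff 𝓘(ℝ, ℂ) 𝓘(ℝ, ℍ[ℝ]) ∞ f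
  imaginary : ∀ p, (f p).re = 0
  immersion : ∀ p, Function.Injective (diff f p)

/-- A conformally parametrized surface. -/
structure IsConformalSurface (f : M → ℍ[ℝ]) : Prop extends IsSurface f where
  conformal : ∀ p, IsConformalMap (diff f p)

/-- The Gauss map of a conformal surface: for conformal coordinates `u + i v` one has
`f_u f_v = f_u × f_v = E n` with `E = |f_u|²`. -/
def gaussMap (f : M → ℍ[ℝ]) (p : M) : ℍ[ℝ] :=
  (‖diff f p 1‖ ^ 2)⁻¹ • (diff f p 1 * diff f p Complex.I)

/-- The identification `i ↦ n` of `ℂ` with the (trivial) normal bundle `ℝ ⊕ ℝ n` of the surface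
`f` in the quaternions. -/
def toNormal (f : M → ℍ[ℝ]) (p : M) (z : ℂ) : ℍ[ℝ] :=
  (z.re : ℍ[ℝ]) + z.im • gaussMap f p

end Surfaces

/-- The derivative at `z` of the inverse of a chart, a linear map into the tangent space of `M` at
`e.symm z`. -/
def chartDiff {M : Type*} [TopologicalSpace M] [ChartedSpace ℂ M] (e : OpenPartialHomeomorph M ℂ)
    (z : ℂ) : ℂ →L[ℂ] ℂ :=
  mfderiv 𝓘(ℂ, ℂ) 𝓘(ℂ, ℂ) e.symm z

/-- A holomorphic quadratic differential: a complex quadratic form `q p` on each tangent space,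
whose coefficient is a holomorphic function in every chart. -/
structure QuadraticDifferential (M : Type*) [TopologicalSpace M] [ChartedSpace ℂ M] where
  toFun : M → ℂ → ℂ
  quadratic : ∀ p c v, toFun p (c * v) = c ^ 2 * toFun p v
  holomorphic : ∀ e ∈ atlas ℂ M, DifferentiableOn ℂ
    (fun z : ℂ => toFun (e.symm z) (chartDiff e z 1)) e.target

instance (M : Type*) [TopologicalSpace M] [ChartedSpace ℂ M] :
    CoeFun (QuadraticDifferential M) (fun _ => M → ℂ → ℂ) :=
  ⟨QuadraticDifferential.toFun⟩

section Transformations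

variable {M : Type*} [TopologicalSpace M] [ChartedSpace ℂ M]

/-- `f` is isothermic with curvature line net given by `q`: around each point there is a
holomorphic coordinate `w = u + i v` with `q = dw²`, such that `(u, v)` are conformal curvature
line parameters of `f`, that is, `⟨df, df⟩ = E (du² + dv²)` and
`⟨df, dn⟩ = -E (κ₁ du² + κ₂ dv²)`. Umbilics are allowed. -/
def IsIsothermic (q : QuadraticDifferential M) (f : M → ℍ[ℝ]) : Prop :=
  IsConformalSurface f ∧
  ∀ p, ∃ w : M → ℂ, ∀ᶠ x in 𝓝 p,
    MDifferentiableAt 𝓘(ℂ, ℂ) 𝓘(ℂ, ℂ) w x ∧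
    (∀ v : ℂ, q x v = cdiff w x v ^ 2) ∧
    ∃ E κ₁ κ₂ : ℝ, 0 < E ∧ ∀ v : ℂ,
      inner ℝ (diff f x v) (diff f x v)
        = E * ((cdiff w x v).re ^ 2 + (cdiff w x v).im ^ 2) ∧
      inner ℝ (diff f x v) (diff (gaussMap f) x v)
        = -E * (κ₁ * (cdiff w x v).re ^ 2 + κ₂ * (cdiff w x v).im ^ 2)

/-- `g` is a Christoffel dual of `f`, normalized by `q`: `df dg = q` as quadratic forms, where `q`
takes values in the normal bundle of `f`, identified with `ℂ` by `n ↦ i`. For `q = dw²`,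
`w = u + i v`, this is `df dg = (du² - dv²) + 2 n du dv`, or
`dg = -(f_u du - f_v dv) / E`. -/
def IsChristoffelDual (q : QuadraticDifferential M) (f g : M → ℍ[ℝ]) : Prop :=
  IsConformalSurface f ∧ IsSurface g ∧
  ∀ p v, diff f p v * diff g p v = toNormal f p (q p v)

/-- The differential `df*` of any (possibly only locally defined) Christoffel dual `f*` of `f`,
normalized by `q`, as obtained by solving `df df* = q`. -/
def dualForm (q : QuadraticDifferential M) (f : M → ℍ[ℝ]) (p : M) (v : ℂ) : ℍ[ℝ] :=
  (diff f p v)⁻¹ * toNormal f p (q p v)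

theorem IsChristoffelDual.diff_eq {q : QuadraticDifferential M} {f g : M → ℍ[ℝ]}
    (h : IsChristoffelDual q f g) (p : M) (v : ℂ) : diff g p v = dualForm q f p v := by
  by_cases hv : v = 0
  · subst hv
    simp [dualForm]
  · have hne : diff f p v ≠ 0 := fun h0 =>
      hv (h.1.immersion p (h0.trans (map_zero (diff f p)).symm))
    rw [dualForm, ← h.2.2 p v, inv_mul_cancel_left₀ hne]

/-- `g` is a Darboux transform `D_t(f)` of `f`, normalized by `q`: it solves the Riccati equation
`dg = t (g - f) df* (g - f)`. -/
def IsDarbouxTransform (q : QuadraticDifferential M) (t : ℝ) (f g : M → ℍ[ℝ]) : Prop :=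
  IsConformalSurface f ∧ IsSurface g ∧ (∀ p, g p ≠ f p) ∧
  ∀ p v, diff g p v = t • ((g p - f p) * dualForm q f p v * (g p - f p))

end Transformations

/-- A Möbius transformation `x ↦ (a x + b) (c x + d)⁻¹` of Euclidean 3-space (with `∞` adjoined),
given by an invertible quaternionic matrix preserving the imaginary quaternions. -/
structure Moebius where
  (a b c d : ℍ[ℝ])
  invertible : IsUnit !![a, b; c, d]
  maps_imaginary : ∀ x : ℍ[ℝ], x.re = 0 → c * x + d ≠ 0 → ((a * x + b) * (c * x + d)⁻¹).re = 0

/-- The value at `x`, meaningful where `x` is not mapped to `∞`. -/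
def Moebius.apply (μ : Moebius) (x : ℍ[ℝ]) : ℍ[ℝ] :=
  (μ.a * x + μ.b) * (μ.c * x + μ.d)⁻¹

/-- `μ` does not map `x` to `∞`. -/
def Moebius.FiniteAt (μ : Moebius) (x : ℍ[ℝ]) : Prop :=
  μ.c * x + μ.d ≠ 0

section Goursat

variable {M : Type*} [TopologicalSpace M] [ChartedSpace ℂ M]

/-- `g = (μ ∘ f*)*` is the Goursat transform of `f` obtained from its Christoffel dual
`f* = fs`. -/
def IsGoursatTransformVia (q : QuadraticDifferential M) (μ : Moebius)
    (f fs g : M → ℍ[ℝ]) : Prop :=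
  IsChristoffelDual q f fs ∧ (∀ p, μ.FiniteAt (fs p)) ∧
  IsChristoffelDual q (fun p => μ.apply (fs p)) g

/-- `g` is a Goursat transform `G_μ(f)` of `f`. -/
def IsGoursatTransform (q : QuadraticDifferential M) (μ : Moebius) (f g : M → ℍ[ℝ]) : Prop :=
  ∃ fs : M → ℍ[ℝ], IsGoursatTransformVia q μ f fs g

/-- The completion `f̂* = f* + (1/t) (f̂ - f)⁻¹` of Bianchi's quadrilateral. -/
def bianchi (t : ℝ) (f fs fhat : M → ℍ[ℝ]) (p : M) : ℍ[ℝ] :=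
  fs p + (1 / t) • (fhat p - f p)⁻¹

end Goursat

end Isothermic

end

/-!
The proof rests on first-order quaternionic algebra at each point and on one second-order fact.

For a conformal surface `f` with Gauss map `n` write `ν(z) = Re z + Im z n`. Then `n² = -1`, `n`
anticommutes with tangent vectors, and `df v = ν(v) df 1`. Hence the dual form `(df)⁻¹ ν(q)` is real
linear and conformal, a Christoffel dual has Gauss map `-n`, and Christoffel duality is symmetric
(`IsChristoffelDual.symm`).

Both the Darboux transform and Möbius maps act on differentials by pointwise similarities:
`df̂ = -t R df* R̄` with `R = f̂ - f`, and `d(μ ∘ x) = ρ B̄ dx B` with `B = (c x + d)⁻¹` and a real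
constant `ρ` (`Moebius.exists_real_factor`). If `dg = κ S df S̄`, then the Gauss maps are related by
`n_g = S n_f S⁻¹`, so that dual forms are related by `κ⁻¹ S̄⁻¹ (·) S⁻¹`. From this one reads off
* Bianchi's quadrilateral: `f̂* = f* + (1/t) (f̂ - f)⁻¹` has `df̂* = (1/t) R⁻¹ df R⁻¹`, which is both
  the dual form of `f̂` and the Riccati equation of `D_t(f*)`;
* Möbius invariance of `D_t`: since also `μ(y) - μ(x) = ρ B̄_x (y - x) B_y = ρ B̄_y (y - x) B_x`, the
  Riccati equation for `(x, y)` becomes the one for `(μ ∘ x, μ ∘ y)`.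

Applying the first to `(f, f*, f̂)`, the second to `(f*, f̂*)` and the first again to
`(μ ∘ f*, (μ ∘ f*)*, μ ∘ f̂*)` yields all edges of the cube.

Finally, every surface of the cube has a Christoffel dual, and this makes it isothermic: the second
fundamental forms of `f` and of its dual `g` are both symmetric. With `q = dw²`, `w = u + i v`, the
Gauss maps are opposite and `dg` is proportional to `f_u du - f_v dv`, so symmetry for `f` gives
`⟨f_u, n_v⟩ = ⟨f_v, n_u⟩` and symmetry for `g` gives `⟨f_u, n_v⟩ = -⟨f_v, n_u⟩`. Both vanish, which
says that `(u, v)` are curvature line parameters (`IsChristoffelDual.isIsothermic`).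
-/

namespace Isothermic

variable {M : Type*} [TopologicalSpace M] [ChartedSpace ℂ M]

/-! ### Imaginary quaternions -/

theorem star_eq_neg_of_re_eq_zero {x : ℍ[ℝ]} (hx : x.re = 0) : star x = -x := by
  ext <;> simp [hx]

theorem mul_self_of_re_eq_zero {x : ℍ[ℝ]} (hx : x.re = 0) : x * x = ((-‖x‖ ^ 2 : ℝ) : ℍ[ℝ]) := by
  have h := Quaternion.self_mul_star x
  rw [star_eq_neg_of_re_eq_zero hx, Quaternion.normSq_eq_norm_mul_self] at h
  rw [mul_neg, neg_eq_iff_eq_neg] at h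
  rw [h, ← sq, ← Quaternion.coe_neg]

theorem re_inv_of_re_eq_zero {x : ℍ[ℝ]} (hx : x.re = 0) : x⁻¹.re = 0 := by
  simp [Quaternion.inv_def, hx]

/-- A linear map which multiplies all lengths by the same nonzero factor is conformal. The factor is
written `|k|`, so that `k` may be given by any expression. -/
theorem isConformalMap_of_norm {L : ℂ →L[ℝ] ℍ[ℝ]} {k : ℝ} (hk : k ≠ 0)
    (h : ∀ v, ‖L v‖ = |k| * ‖v‖) : IsConformalMap L := by
  refine ⟨k, hk, ⟨(k⁻¹ • L).toLinearMap, fun v => ?_⟩, ?_⟩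
  · simp [norm_smul, h, hk]
  · ext v <;> simp [hk]

/-! ### The frame equations of a conformal surface -/

section Gauss

theorem IsSurface.mdifferentiableAt {f : M → ℍ[ℝ]} (hf : IsSurface f) (p : M) :
    MDifferentiableAt 𝓘(ℝ, ℂ) 𝓘(ℝ, ℍ[ℝ]) f p :=
  (hf.smooth p).mdifferentiableAt (by simp)

theorem IsSurface.hasMFDerivAt {f : M → ℍ[ℝ]} (hf : IsSurface f) (p : M) :
    HasMFDerivAt 𝓘(ℝ, ℂ) 𝓘(ℝ, ℍ[ℝ]) f p (diff f p) :=
  (hf.mdifferentiableAt p).hasMFDerivAt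

theorem IsSurface.diff_ne_zero {f : M → ℍ[ℝ]} (hf : IsSurface f) (p : M) {v : ℂ} (hv : v ≠ 0) :
    diff f p v ≠ 0 := fun h =>
  hv (hf.immersion p (h.trans (map_zero (diff f p)).symm))

theorem hasMFDerivAt_comp_of_hasFDerivAt {E : Type*} [NormedAddCommGroup E] [NormedSpace ℝ E]
    {f : M → ℍ[ℝ]} {p : M} {L : ℂ →L[ℝ] ℍ[ℝ]} {φ : ℍ[ℝ] → E} {A : ℍ[ℝ] →L[ℝ] E}
    (hf : HasMFDerivAt 𝓘(ℝ, ℂ) 𝓘(ℝ, ℍ[ℝ]) f p L) (hφ : HasFDerivAt φ A (f p)) :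
    HasMFDerivAt 𝓘(ℝ, ℂ) 𝓘(ℝ, E) (fun x => φ (f x)) p (A.comp L) :=
  HasMFDerivAt.comp p hφ.hasMFDerivAt hf

theorem IsSurface.diff_re {f : M → ℍ[ℝ]} (hf : IsSurface f) (p : M) (v : ℂ) :
    (diff f p v).re = 0 := by
  have h := hasMFDerivAt_comp_of_hasFDerivAt (hf.hasMFDerivAt p)
    (φ := fun x => inner ℝ (1 : ℍ[ℝ]) x) (innerSL ℝ (1 : ℍ[ℝ])).hasFDerivAt
  have h0 : (fun x => inner ℝ (1 : ℍ[ℝ]) (f x)) = fun _ => (0 : ℝ) := by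
    funext x; simp [Quaternion.inner_def, hf.imaginary]
  rw [h0] at h
  have h1 := hasMFDerivAt_unique h (hasMFDerivAt_const (0 : ℝ) p)
  have h2 := congrArg (fun A : ℂ →L[ℝ] ℝ => A v) h1
  have h3 : inner ℝ (1 : ℍ[ℝ]) (diff f p v) = 0 := h2
  simpa [Quaternion.inner_def] using h3

/-- The frame equations of a conformal surface: `n² = -1`, `f_v = n f_u`, and `n` anticommutes
with tangent vectors. -/
theorem IsConformalSurface.gaussMap_spec {f : M → ℍ[ℝ]} (hf : IsConformalSurface f) (p : M) :
    gaussMap f p * gaussMap f p = -1 ∧ diff f p Complex.I = gaussMap f p * diff f p 1 ∧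
      diff f p 1 * gaussMap f p = -(gaussMap f p * diff f p 1) := by
  obtain ⟨c, hc, h⟩ := (isConformalMap_iff _).1 (hf.conformal p)
  have hX := hf.diff_re p 1
  have hY := hf.diff_re p Complex.I
  have hXX := mul_self_of_re_eq_zero hX
  have hYY := mul_self_of_re_eq_zero hY
  have h11 := h 1 1
  have hII := h Complex.I Complex.I
  have h1I := h 1 Complex.I
  unfold gaussMap
  generalize diff f p 1 = X at *
  generalize diff f p Complex.I = Y at *
  rw [real_inner_self_eq_norm_sq] at h11 hII
  have e1 : ‖X‖ ^ 2 = c := by simpa using h11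
  have e2 : ‖Y‖ ^ 2 = c := by simpa using hII
  have hYX : Y * X = -(X * Y) := by
    have h3 : (X * Y).re = 0 := by
      have : (X * star Y).re = 0 := by rw [← Quaternion.inner_def, h1I]; simp
      rwa [star_eq_neg_of_re_eq_zero hY, mul_neg, Quaternion.re_neg, neg_eq_zero] at this
    have := star_eq_neg_of_re_eq_zero h3
    rwa [star_mul, star_eq_neg_of_re_eq_zero hX, star_eq_neg_of_re_eq_zero hY, neg_mul_neg] at this
  rw [e1] at hXX ⊢
  rw [e2] at hYY
  have a1 : X * Y * X = (c : ℍ[ℝ]) * Y := by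
    rw [mul_assoc, hYX, mul_neg, ← mul_assoc, hXX]; push_cast; simp
  have a2 : X * (X * Y) = -((c : ℍ[ℝ]) * Y) := by
    rw [← mul_assoc, hXX]; push_cast; simp
  refine ⟨?_, ?_, ?_⟩
  · rw [smul_mul_smul_comm, ← mul_assoc, a1, mul_assoc, hYY, ← Quaternion.coe_mul,
      Quaternion.smul_coe]
    rw [show c⁻¹ * c⁻¹ * (c * -c) = -1 by field_simp]
    simp
  · rw [smul_mul_assoc, a1, Quaternion.coe_mul_eq_smul, smul_smul, inv_mul_cancel₀ hc.ne', one_smul]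
  · rw [mul_smul_comm, a2, smul_mul_assoc, a1, smul_neg]

/-- The frame equations determine the Gauss map. -/
theorem IsSurface.gaussMap_eq {g : M → ℍ[ℝ]} (hg : IsSurface g) {p : M} {n : ℍ[ℝ]}
    (h1 : diff g p Complex.I = n * diff g p 1) (h2 : diff g p 1 * n = -(n * diff g p 1)) :
    gaussMap g p = n := by
  have hX := hg.diff_re p 1
  have hX0 : ‖diff g p 1‖ ≠ 0 := norm_ne_zero_iff.2 (hg.diff_ne_zero p one_ne_zero)
  rw [gaussMap, h1, ← mul_assoc, h2, neg_mul, mul_assoc, mul_self_of_re_eq_zero hX,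
    Quaternion.mul_coe_eq_smul, ← smul_neg, smul_neg, ← neg_smul, smul_smul]
  rw [show (‖diff g p 1‖ ^ 2)⁻¹ * -(-‖diff g p 1‖ ^ 2) = 1 by field_simp]
  simp

/-- The identification of `ℂ` with the normal bundle is multiplicative, as `n² = -1`. -/
theorem IsConformalSurface.toNormal_mul {f : M → ℍ[ℝ]} (hf : IsConformalSurface f)
    (p : M) (z w : ℂ) :
    toNormal f p (z * w) = toNormal f p z * toNormal f p w := by
  have h := (hf.gaussMap_spec p).1
  simp only [toNormal, ← Quaternion.coe_mul_eq_smul]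
  generalize gaussMap f p = n at h
  have c1 : ∀ r : ℝ, n * (r : ℍ[ℝ]) = r * n := fun r => (Quaternion.coe_commutes r n).symm
  simp only [Complex.mul_re, Complex.mul_im, mul_add, add_mul]
  have c2 : ((z.im : ℝ) : ℍ[ℝ]) * n * (w.im * n) = -((z.im * w.im : ℝ) : ℍ[ℝ]) := by
    rw [mul_assoc, ← mul_assoc n, c1, mul_assoc (w.im : ℍ[ℝ]), h]; push_cast; simp
  have c3 : ((z.im : ℝ) : ℍ[ℝ]) * n * w.re = ((z.im * w.re : ℝ) : ℍ[ℝ]) * n := by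
    rw [mul_assoc, c1]; push_cast; simp [mul_assoc]
  rw [c2, c3]; push_cast
  noncomm_ring

/-- Multiplication by `i` on the tangent space is left multiplication by the Gauss map. -/
theorem IsConformalSurface.diff_eq_toNormal_mul {f : M → ℍ[ℝ]} (hf : IsConformalSurface f)
    (p : M) (v : ℂ) :
    diff f p v = toNormal f p v * diff f p 1 := by
  have h : v = v.re • (1 : ℂ) + v.im • Complex.I := by simp
  conv_lhs => rw [h]
  rw [map_add, map_smul, map_smul, (hf.gaussMap_spec p).2.1, toNormal, add_mul, smul_mul_assoc,
    Quaternion.coe_mul_eq_smul]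

theorem IsConformalSurface.norm_toNormal {f : M → ℍ[ℝ]} (hf : IsConformalSurface f)
    (p : M) (v : ℂ) : ‖toNormal f p v‖ = ‖v‖ := by
  obtain ⟨c, hc, h⟩ := (isConformalMap_iff _).1 (hf.conformal p)
  have h1 := h 1 1
  have hv := h v v
  simp only [real_inner_self_eq_norm_sq] at h1 hv
  rw [hf.diff_eq_toNormal_mul, norm_mul, mul_pow, h1, norm_one, one_pow, mul_one, mul_comm] at hv
  exact (sq_eq_sq₀ (norm_nonneg _) (norm_nonneg _)).1 (mul_left_cancel₀ hc.ne' hv)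

theorem toNormal_one (f : M → ℍ[ℝ]) (p : M) : toNormal f p 1 = 1 := by
  simp [toNormal]

theorem toNormal_zero (f : M → ℍ[ℝ]) (p : M) : toNormal f p 0 = 0 := by
  simp [toNormal]

theorem toNormal_I (f : M → ℍ[ℝ]) (p : M) : toNormal f p Complex.I = gaussMap f p := by
  simp [toNormal]

theorem IsConformalSurface.toNormal_ne_zero {f : M → ℍ[ℝ]} (hf : IsConformalSurface f) (p : M)
    {v : ℂ} (hv : v ≠ 0) : toNormal f p v ≠ 0 := by
  rw [← norm_ne_zero_iff, hf.norm_toNormal]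
  exact norm_ne_zero_iff.2 hv

theorem IsConformalSurface.diff_mul_gaussMap {f : M → ℍ[ℝ]} (hf : IsConformalSurface f) (p : M)
    (v : ℂ) : diff f p v * gaussMap f p = -(gaussMap f p * diff f p v) := by
  have : toNormal f p v * gaussMap f p = gaussMap f p * toNormal f p v := by
    rw [← toNormal_I, ← hf.toNormal_mul, ← hf.toNormal_mul, mul_comm]
  rw [hf.diff_eq_toNormal_mul p v, mul_assoc, (hf.gaussMap_spec p).2.2, mul_neg, ← mul_assoc, this,
    mul_assoc]

theorem toNormal_eq_of_gaussMap_eq {f g : M → ℍ[ℝ]} {p : M} {S : ℍ[ℝ]} (hS : S ≠ 0)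
    (h : gaussMap g p = S * gaussMap f p * S⁻¹) (z : ℂ) :
    toNormal g p z = S * toNormal f p z * S⁻¹ := by
  rw [toNormal, toNormal, h, mul_add, add_mul, ← Quaternion.coe_commutes, mul_assoc (z.re : ℍ[ℝ]),
    mul_inv_cancel₀ hS, mul_one, mul_smul_comm, smul_mul_assoc]

end Gauss

/-! ### Christoffel duality -/

section Christoffel

variable {q : QuadraticDifferential M}

theorem QuadraticDifferential.apply_eq (q : QuadraticDifferential M) (p : M) (v : ℂ) :
    q p v = v ^ 2 * q p 1 := by
  simpa using q.quadratic p v 1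

/-- Since `df v = ν(v) df 1`, where `ν` is the identification of `ℂ` with the normal bundle, the
dual form is the real linear map `v ↦ (df 1)⁻¹ ν(q(1) v)`. -/
theorem IsConformalSurface.dualForm_eq {f : M → ℍ[ℝ]} (hf : IsConformalSurface f) (p : M) (v : ℂ) :
    dualForm q f p v = (diff f p 1)⁻¹ * toNormal f p (q p 1 * v) := by
  by_cases hv : v = 0
  · subst hv; simp [dualForm, toNormal_zero]
  · have h := hf.toNormal_ne_zero p hv
    rw [dualForm, hf.diff_eq_toNormal_mul p v, q.apply_eq p v, mul_inv_rev,
      show v ^ 2 * q p 1 = v * (q p 1 * v) by ring, hf.toNormal_mul p v, mul_assoc,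
      inv_mul_cancel_left₀ h]

/-- Converse of `IsChristoffelDual.diff_eq`: integrating the dual form gives a dual surface. -/
theorem IsConformalSurface.isChristoffelDual {f g : M → ℍ[ℝ]} (hf : IsConformalSurface f)
    (hg : IsSurface g) (h : ∀ p v, diff g p v = dualForm q f p v) : IsChristoffelDual q f g := by
  refine ⟨hf, hg, fun p v => ?_⟩
  by_cases hv : v = 0
  · subst hv
    rw [map_zero, zero_mul, q.apply_eq]
    simp [toNormal_zero]
  · rw [h, dualForm, mul_inv_cancel_left₀ (hf.diff_ne_zero p hv)]

/-- The quadratic differential has no zeros, because a Christoffel dual is an immersion. -/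
theorem IsChristoffelDual.apply_one_ne_zero {f g : M → ℍ[ℝ]} (h : IsChristoffelDual q f g) (p : M) :
    q p 1 ≠ 0 := by
  intro h0
  refine h.2.1.diff_ne_zero p one_ne_zero ?_
  rw [h.diff_eq, h.1.dualForm_eq, h0, zero_mul, toNormal_zero, mul_zero]

/-- Christoffel dual surfaces have opposite Gauss maps. -/
theorem IsChristoffelDual.gaussMap_eq {f g : M → ℍ[ℝ]} (h : IsChristoffelDual q f g) :
    gaussMap g = -gaussMap f := by
  funext p
  obtain ⟨-, -, h3⟩ := h.1.gaussMap_spec p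
  have hX := h.1.diff_ne_zero p one_ne_zero
  have h4 : (diff f p 1)⁻¹ * gaussMap f p = -(gaussMap f p * (diff f p 1)⁻¹) := by
    apply mul_left_cancel₀ hX
    rw [mul_inv_cancel_left₀ hX, mul_neg, ← mul_assoc, h3, neg_mul, neg_neg, mul_assoc,
      mul_inv_cancel₀ hX, mul_one]
  have h5 : toNormal f p (q p 1) * gaussMap f p = gaussMap f p * toNormal f p (q p 1) := by
    rw [← toNormal_I, ← h.1.toNormal_mul, ← h.1.toNormal_mul, mul_comm]
  refine h.2.1.gaussMap_eq ?_ ?_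
  · rw [h.diff_eq, h.diff_eq, h.1.dualForm_eq, h.1.dualForm_eq, h.1.toNormal_mul, toNormal_I,
      mul_one, h5, Pi.neg_apply, ← mul_assoc, h4, neg_mul, neg_mul, mul_assoc]
  · rw [h.diff_eq, h.1.dualForm_eq, mul_one, Pi.neg_apply, mul_neg, mul_assoc, h5, ← mul_assoc, h4]
    simp [mul_assoc]

theorem IsChristoffelDual.isConformalSurface {f g : M → ℍ[ℝ]} (h : IsChristoffelDual q f g) :
    IsConformalSurface g := by
  refine ⟨h.2.1, fun p => isConformalMap_of_norm (k := ‖diff f p 1‖⁻¹ * ‖q p 1‖) ?_ fun v => ?_⟩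
  · exact mul_ne_zero (inv_ne_zero (norm_ne_zero_iff.2 (h.1.diff_ne_zero p one_ne_zero)))
      (norm_ne_zero_iff.2 (h.apply_one_ne_zero p))
  · rw [h.diff_eq, h.1.dualForm_eq, norm_mul, norm_inv, h.1.norm_toNormal, norm_mul,
      abs_of_nonneg (by positivity), mul_assoc]

/-- Christoffel duality is symmetric: `q` is conjugated by `df`, which anticommutes with the
normal, and the sign is absorbed by the change of sign of the Gauss map. -/
theorem IsChristoffelDual.symm {f g : M → ℍ[ℝ]} (h : IsChristoffelDual q f g) :
    IsChristoffelDual q g f := by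
  refine ⟨h.isConformalSurface, h.1.toIsSurface, fun p v => ?_⟩
  by_cases hv : v = 0
  · subst hv
    rw [map_zero, zero_mul, q.apply_eq]
    simp [toNormal_zero]
  have hX := h.1.diff_ne_zero p hv
  have h4 := h.1.diff_mul_gaussMap p v
  apply mul_left_cancel₀ hX
  rw [← mul_assoc, h.2.2 p v, toNormal, toNormal, h.gaussMap_eq, mul_add, add_mul,
    Quaternion.coe_commutes, Pi.neg_apply, mul_smul_comm, mul_neg, h4, neg_neg, smul_mul_assoc]

end Christoffel

/-! ### Differentials related by pointwise similarities -/

section Similarity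

variable {q : QuadraticDifferential M}

theorem star_mul_self_eq_coe (S : ℍ[ℝ]) : star S * S = ((‖S‖ ^ 2 : ℝ) : ℍ[ℝ]) := by
  rw [Quaternion.star_mul_self, Quaternion.normSq_eq_norm_mul_self, sq]

/-- A surface whose differential is obtained from that of a conformal surface by the (pointwise)
similarities `x ↦ κ S x S̄` of Euclidean space is conformal. -/
theorem IsConformalSurface.of_diff_eq {f g : M → ℍ[ℝ]} (hf : IsConformalSurface f)
    (hg : IsSurface g)
    (h : ∀ p, ∃ (κ : ℝ) (S : ℍ[ℝ]), ∀ v, diff g p v = κ • (S * diff f p v * star S)) :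
    IsConformalSurface g := by
  refine ⟨hg, fun p => ?_⟩
  obtain ⟨κ, S, hS⟩ := h p
  have key : ∀ v, ‖diff g p v‖ = ‖diff g p 1‖ * ‖v‖ := fun v => by
    rw [hS, hS, hf.diff_eq_toNormal_mul p v]
    simp only [norm_smul, norm_mul, hf.norm_toNormal]
    ring
  refine isConformalMap_of_norm (norm_ne_zero_iff.2 (hg.diff_ne_zero p one_ne_zero)) fun v => ?_
  rw [key, abs_norm]

/-- Similarities `x ↦ κ S x S̄` transform the normal by the rotation `n ↦ S n S⁻¹`, whatever the
sign of `κ`, because the normal is quadratic in the differential. -/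
theorem IsConformalSurface.gaussMap_of_diff_eq {f g : M → ℍ[ℝ]} (hf : IsConformalSurface f)
    (hg : IsSurface g) {p : M} {κ : ℝ} {S : ℍ[ℝ]} (hS : S ≠ 0)
    (h : ∀ v, diff g p v = κ • (S * diff f p v * star S)) :
    gaussMap g p = S * gaussMap f p * S⁻¹ := by
  obtain ⟨-, h2, h3⟩ := hf.gaussMap_spec p
  have hs : star S = ((‖S‖ ^ 2 : ℝ) : ℍ[ℝ]) * S⁻¹ := by
    rw [← star_mul_self_eq_coe, mul_assoc, mul_inv_cancel₀ hS, mul_one]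
  refine hg.gaussMap_eq ?_ ?_
  · rw [h, h, h2, mul_smul_comm]
    congr 1
    simp only [mul_assoc, inv_mul_cancel_left₀ hS]
  · rw [h, smul_mul_assoc, mul_smul_comm, ← smul_neg]
    congr 1
    -- `S̄` and `S⁻¹` differ by a real factor, which commutes with everything
    rw [hs]
    simp only [Quaternion.coe_mul_eq_smul, smul_mul_assoc, mul_smul_comm, ← smul_neg]
    congr 1
    simp only [mul_assoc, inv_mul_cancel_left₀ hS]
    rw [← mul_assoc (diff f p 1), h3]
    simp [mul_assoc]

/-- If `dg = κ S df S̄`, then the dual forms are related by the similarity with factor `κ⁻¹` and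
`S̄⁻¹` in place of `S`. -/
theorem IsConformalSurface.dualForm_of_diff_eq {f g : M → ℍ[ℝ]} (hf : IsConformalSurface f)
    (hg : IsSurface g) {p : M} {κ : ℝ} {S : ℍ[ℝ]} (hS : S ≠ 0)
    (h : ∀ v, diff g p v = κ • (S * diff f p v * star S)) (v : ℂ) :
    dualForm q g p v = κ⁻¹ • ((star S)⁻¹ * dualForm q f p v * S⁻¹) := by
  rw [dualForm, toNormal_eq_of_gaussMap_eq hS (hf.gaussMap_of_diff_eq hg hS h), h, dualForm, smul_inv₀,
    smul_mul_assoc, mul_inv_rev, mul_inv_rev]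
  simp only [mul_assoc, inv_mul_cancel_left₀ hS]

end Similarity

/-! ### Symmetry of the second fundamental form -/

section SecondFundamentalForm

/-- The Gauss map may be computed in any conformal frame. -/
theorem IsConformalSurface.gaussMap_eq_of_frame {f : M → ℍ[ℝ]} (hf : IsConformalSurface f) (p : M)
    {c : ℂ} (hc : c ≠ 0) :
    gaussMap f p = (‖diff f p c‖ ^ 2)⁻¹ • (diff f p c * diff f p (c * Complex.I)) := by
  have hX0 : ‖diff f p c‖ ≠ 0 := norm_ne_zero_iff.2 (hf.diff_ne_zero p hc)
  have h4 := hf.diff_mul_gaussMap p c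
  have h5 : diff f p (c * Complex.I) = gaussMap f p * diff f p c := by
    rw [hf.diff_eq_toNormal_mul p c, hf.diff_eq_toNormal_mul, mul_comm c, hf.toNormal_mul,
      toNormal_I, mul_assoc]
  rw [h5, ← mul_assoc, h4, neg_mul, mul_assoc, mul_self_of_re_eq_zero (hf.diff_re p c),
    Quaternion.mul_coe_eq_smul, ← neg_smul, smul_smul]
  simp [hX0]

theorem IsConformalSurface.inner_diff_gaussMap {f : M → ℍ[ℝ]} (hf : IsConformalSurface f) (p : M)
    (v : ℂ) : inner ℝ (diff f p v) (gaussMap f p) = 0 := by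
  have re_comm : ∀ a b : ℍ[ℝ], (a * b).re = (b * a).re := fun a b => by
    simp only [Quaternion.re_mul]; ring
  have hX := hf.diff_ne_zero p one_ne_zero
  have h3 := (hf.gaussMap_spec p).2.2
  have hn : (gaussMap f p).re = 0 := by
    have h : (diff f p 1 * (gaussMap f p * (diff f p 1)⁻¹)).re = -(gaussMap f p).re := by
      rw [← mul_assoc, h3, neg_mul, mul_assoc, mul_inv_cancel₀ hX, mul_one, Quaternion.re_neg]
    rw [re_comm, mul_assoc, inv_mul_cancel₀ hX, mul_one] at h
    linarith
  have h4 := congrArg QuaternionAlgebra.re (hf.diff_mul_gaussMap p v)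
  rw [Quaternion.inner_def, star_eq_neg_of_re_eq_zero hn, mul_neg, Quaternion.re_neg]
  rw [Quaternion.re_neg, re_comm] at h4
  rw [re_comm]
  linarith

/-- Differentiability in the preferred chart implies differentiability on `M`, continuity included,
and the tangent space at `p` is trivialized by that chart. -/
theorem diff_eq_fderiv {g : M → ℍ[ℝ]} {p : M}
    (h : DifferentiableAt ℝ (fun z => g ((chartAt ℂ p).symm z)) (chartAt ℂ p p)) :
    diff g p = fderiv ℝ (fun z => g ((chartAt ℂ p).symm z)) (chartAt ℂ p p) := by
  have hc : ContinuousAt g p := by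
    refine (h.continuousAt.comp (f := chartAt ℂ p) (x := p)
      ((chartAt ℂ p).continuousAt (mem_chart_source ℂ p))).congr ?_
    filter_upwards [(chartAt ℂ p).open_source.mem_nhds (mem_chart_source ℂ p)] with x hx
    simp [(chartAt ℂ p).left_inv hx]
  have h1 : HasMFDerivAt 𝓘(ℝ, ℂ) 𝓘(ℝ, ℍ[ℝ]) g p
      (fderiv ℝ (fun z => g ((chartAt ℂ p).symm z)) (chartAt ℂ p p)) :=
    ⟨hc, h.hasFDerivAt.hasFDerivWithinAt⟩
  exact h1.mfderiv

/-- The complex derivative, restricted to real scalars, is the real derivative: over either field the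
model is the identity, so that the same map in charts is differentiated. -/
theorem hasMFDerivAt_restrictScalars {w : ℂ → M} {z : ℂ} {L : ℂ →L[ℂ] ℂ}
    (h : HasMFDerivAt 𝓘(ℂ, ℂ) 𝓘(ℂ, ℂ) w z L) :
    HasMFDerivAt 𝓘(ℝ, ℂ) 𝓘(ℝ, ℂ) w z (L.restrictScalars ℝ) :=
  ⟨h.1, HasFDerivWithinAt.restrictScalars ℝ h.2⟩

variable [IsManifold 𝓘(ℂ, ℂ) ω M]

/-- In the preferred chart at `p`, the differential of `f` is, up to a nonzero complex factor `c`,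
the differential `diff f` at the nearby point, which refers to the preferred chart there; `c` is the
derivative of the holomorphic change of charts. -/
theorem IsSurface.exists_fderiv_comp_chart_symm_eq {f : M → ℍ[ℝ]} (hf : IsSurface f) (p : M)
    {z : ℂ} (hz : z ∈ (chartAt ℂ p).target) : ∃ c : ℂ, c ≠ 0 ∧
    ∀ v, fderiv ℝ (fun z => f ((chartAt ℂ p).symm z)) z v =
      diff f ((chartAt ℂ p).symm z) (c * v) := by
  have : IsManifold 𝓘(ℂ, ℂ) 1 M := IsManifold.of_le (n := ω) le_top
  have he := mdifferentiable_chart (I := 𝓘(ℂ, ℂ)) p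
  set e := chartAt ℂ p
  have h1 : MDifferentiableAt 𝓘(ℂ, ℂ) 𝓘(ℂ, ℂ) e.symm z := he.symm.mdifferentiableAt hz
  have hinj : Function.Injective (mfderiv 𝓘(ℂ, ℂ) 𝓘(ℂ, ℂ) e.symm z) :=
    he.symm.mfderiv_injective hz
  set L : ℂ →L[ℂ] ℂ := mfderiv 𝓘(ℂ, ℂ) 𝓘(ℂ, ℂ) e.symm z with hL
  have h2 : HasMFDerivAt 𝓘(ℂ, ℂ) 𝓘(ℂ, ℂ) e.symm z L := h1.hasMFDerivAt
  have h3 := HasMFDerivAt.comp z (hf.hasMFDerivAt (e.symm z)) (hasMFDerivAt_restrictScalars h2)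
  have h4 : HasFDerivAt (fun z => f (e.symm z))
      ((diff f (e.symm z)).comp (L.restrictScalars ℝ)) z := h3.hasFDerivAt
  refine ⟨L 1, fun h => ?_, fun v => ?_⟩
  · exact one_ne_zero (α := ℂ) (hinj (h.trans (map_zero L).symm))
  · rw [h4.fderiv]
    have : L v = L 1 * v := by
      rw [mul_comm, ← smul_eq_mul, ← map_smul, smul_eq_mul, mul_one]
    simp [this]

/-- The second fundamental form of a surface is symmetric: differentiating `⟨dF v, N⟩ = 0` in a chart
expresses it by the second derivative of the surface. -/
theorem IsConformalSurface.inner_diff_diff_gaussMap_comm {f : M → ℍ[ℝ]}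
    (hf : IsConformalSurface f) (p : M) (v w : ℂ) :
    inner ℝ (diff f p v) (diff (gaussMap f) p w) =
      inner ℝ (diff f p w) (diff (gaussMap f) p v) := by
  set e := chartAt ℂ p with he
  set z₀ := e p with hz₀
  set F : ℂ → ℍ[ℝ] := fun z => f (e.symm z) with hF
  set N : ℂ → ℍ[ℝ] := fun z => gaussMap f (e.symm z) with hN
  have hz : z₀ ∈ e.target := mem_chart_target ℂ p
  have hFs : ContDiffAt ℝ ∞ F z₀ := by
    have := (contMDiffAt_iff.1 (hf.smooth p)).2
    simpa using! this
  have hev : ∀ᶠ z in 𝓝 z₀, z ∈ e.target := e.open_target.mem_nhds hz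
  have hdF : ContDiffAt ℝ 1 (fderiv ℝ F) z₀ := hFs.fderiv_right (m := 1) (by norm_cast)
  have hNF : N =ᶠ[𝓝 z₀] fun z => (‖fderiv ℝ F z 1‖ ^ 2)⁻¹ •
      (fderiv ℝ F z 1 * fderiv ℝ F z Complex.I) := by
    filter_upwards [hev] with z hz
    obtain ⟨c, hc, h⟩ := hf.exists_fderiv_comp_chart_symm_eq p hz
    rw [hF, h, h, mul_one]
    exact hf.gaussMap_eq_of_frame _ hc
  have hdF1 : ∀ v, DifferentiableAt ℝ (fun z => fderiv ℝ F z v) z₀ := fun v =>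
    (hdF.differentiableAt one_ne_zero).clm_apply (differentiableAt_const v)
  have hdfp : ∀ v, diff f p v = fderiv ℝ F z₀ v := fun v => by
    rw [diff_eq_fderiv (hFs.differentiableAt (by simp))]
  -- the Gauss map is differentiable, so that `diff (gaussMap f)` is its actual derivative
  have hNd : DifferentiableAt ℝ N z₀ := by
    refine DifferentiableAt.congr_of_eventuallyEq ?_ hNF
    refine DifferentiableAt.smul (DifferentiableAt.inv ((hdF1 1).norm_sq ℝ) ?_)
      ((hdF1 1).mul (hdF1 _))
    rw [← hdfp]
    exact pow_ne_zero _ (norm_ne_zero_iff.2 (hf.diff_ne_zero p one_ne_zero))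
  have hdNp : ∀ v, diff (gaussMap f) p v = fderiv ℝ N z₀ v := fun v => by
    rw [diff_eq_fderiv hNd]
  have horth : ∀ v, (fun z => inner ℝ (fderiv ℝ F z v) (N z)) =ᶠ[𝓝 z₀] fun _ => (0 : ℝ) := fun v => by
    filter_upwards [hev] with z hz
    obtain ⟨c, hc, h⟩ := hf.exists_fderiv_comp_chart_symm_eq p hz
    rw [hF, h]
    exact hf.inner_diff_gaussMap _ _
  have hsymm := hFs.isSymmSndFDerivAt (by simp; norm_cast)
  have key : ∀ v w, inner ℝ (fderiv ℝ F z₀ v) (fderiv ℝ N z₀ w) =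
      -inner ℝ (fderiv ℝ (fderiv ℝ F) z₀ w v) (N z₀) := fun v w => by
    have h1 := (horth v).fderiv_eq (𝕜 := ℝ)
    have h2 := congrArg (fun A : ℂ →L[ℝ] ℝ => A w) h1
    simp only [fderiv_inner_apply ℝ (hdF1 v) hNd] at h2
    rw [fderiv_clm_apply (hdF.differentiableAt one_ne_zero) (differentiableAt_const v)] at h2
    simp at h2
    linarith
  rw [hdfp, hdfp, hdNp, hdNp, key, key, hsymm v w]

end SecondFundamentalForm

/-! ### Surfaces with a Christoffel dual are isothermic -/

section Isothermic

variable [IsManifold 𝓘(ℂ, ℂ) ω M] {q : QuadraticDifferential M}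

/-- A surface with a Christoffel dual is isothermic, provided that `q` has local coordinates
`q = dw²`: in these, symmetry of the second fundamental forms of the surface and of its dual forces
the mixed terms to vanish. -/
theorem IsChristoffelDual.isIsothermic {f g : M → ℍ[ℝ]} (h : IsChristoffelDual q f g)
    (hw : ∀ p, ∃ w : M → ℂ, ∀ᶠ x in 𝓝 p,
      MDifferentiableAt 𝓘(ℂ, ℂ) 𝓘(ℂ, ℂ) w x ∧ ∀ v : ℂ, q x v = cdiff w x v ^ 2) :
    IsIsothermic q f := by
  refine ⟨h.1, fun p => ?_⟩
  obtain ⟨w, hw⟩ := hw p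
  refine ⟨w, hw.mono fun x hx => ⟨hx.1, hx.2, ?_⟩⟩
  have hq := hx.2
  have hq0 := h.apply_one_ne_zero x
  set ζ : ℂ := cdiff w x 1 with hζ
  have hlin : ∀ v, cdiff w x v = ζ * v := fun v => by
    rw [hζ, mul_comm, ← smul_eq_mul v, ← map_smul, smul_eq_mul, mul_one]
  have hζ0 : ζ ≠ 0 := fun h0 => hq0 (by rw [hq, ← hζ, h0]; simp)
  -- the frame dual to `(du, dv)`
  set e₁ : ℂ := ζ⁻¹
  set e₂ : ℂ := ζ⁻¹ * Complex.I
  have he₁ : e₁ ≠ 0 := inv_ne_zero hζ0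
  have hdec : ∀ v : ℂ, v = (ζ * v).re • e₁ + (ζ * v).im • e₂ := fun v => by
    have : v = ζ⁻¹ * (ζ * v) := by field_simp
    conv_lhs => rw [this, ← Complex.re_add_im (ζ * v)]
    simp only [e₁, e₂, Complex.real_smul]
    ring
  set X := diff f x e₁
  set Y := diff f x e₂
  set A := diff (gaussMap f) x e₁
  set B := diff (gaussMap f) x e₂
  have hX0 : X ≠ 0 := h.1.diff_ne_zero x he₁
  have hY : Y = gaussMap f x * X := by
    simp only [X, Y, e₂]
    rw [h.1.diff_eq_toNormal_mul, mul_comm ζ⁻¹, h.1.toNormal_mul, toNormal_I, mul_assoc,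
      ← h.1.diff_eq_toNormal_mul]
  have hnorm : ‖Y‖ = ‖X‖ := by
    have : ‖gaussMap f x‖ = 1 := by rw [← toNormal_I, h.1.norm_toNormal, Complex.norm_I]
    rw [hY, norm_mul, this, one_mul]
  have hXY : inner ℝ X Y = 0 := by
    obtain ⟨c, -, hc⟩ := (isConformalMap_iff _).1 (h.1.conformal x)
    rw [hc, Complex.inner]
    simp only [e₂, e₁, Complex.mul_re, Complex.mul_im, Complex.conj_re, Complex.conj_im,
      Complex.I_re, Complex.I_im]
    ring
  have hq1 : q x e₁ = 1 := by rw [hq, hlin]; simp [e₁, hζ0]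
  have hq2 : q x e₂ = -1 := by rw [hq, hlin]; simp [e₂, hζ0]
  have hinv : ∀ {Z : ℍ[ℝ]}, Z.re = 0 → Z⁻¹ = -((‖Z‖ ^ 2)⁻¹ • Z) := fun {Z} hZ => by
    rw [Quaternion.inv_def, Quaternion.normSq_eq_norm_mul_self, star_eq_neg_of_re_eq_zero hZ, sq,
      smul_neg]
  have hg₁ : diff g x e₁ = -((‖X‖ ^ 2)⁻¹ • X) := by
    rw [h.diff_eq, dualForm, hq1, toNormal_one, mul_one, hinv (h.1.diff_re x e₁)]
  have hg₂ : diff g x e₂ = (‖X‖ ^ 2)⁻¹ • Y := by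
    have : toNormal f x (-1) = -1 := by simp [toNormal]
    rw [h.diff_eq, dualForm, hq2, this, mul_neg, mul_one, hinv (h.1.diff_re x e₂), neg_neg,
      ← hnorm]
  have hgn : ∀ v, diff (gaussMap g) x v = -diff (gaussMap f) x v := fun v => by
    rw [h.gaussMap_eq]
    exact congrArg (fun A : ℂ →L[ℝ] ℍ[ℝ] => A v) (mfderiv_neg (f := gaussMap f) (x := x))
  -- the two symmetries give the mixed term with opposite signs
  have hsf := h.1.inner_diff_diff_gaussMap_comm x e₁ e₂
  have hsg := h.isConformalSurface.inner_diff_diff_gaussMap_comm x e₁ e₂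
  rw [hgn, hgn, hg₁, hg₂] at hsg
  change inner ℝ X B = inner ℝ Y A at hsf
  have hX2 : 0 < ‖X‖ ^ 2 := pow_pos (norm_pos_iff.2 hX0) 2
  have hsg' : inner ℝ X B = -inner ℝ Y A := by
    simp only [inner_neg_left, inner_neg_right, real_inner_smul_left, neg_neg] at hsg
    rw [← mul_neg] at hsg
    exact mul_left_cancel₀ (inv_ne_zero hX2.ne') hsg
  have hXB : inner ℝ X B = 0 := by linarith
  have hYA : inner ℝ Y A = 0 := by linarith
  refine ⟨‖X‖ ^ 2, -(inner ℝ X A / ‖X‖ ^ 2), -(inner ℝ Y B / ‖X‖ ^ 2), hX2, fun v => ?_⟩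
  have hv : diff f x v = (ζ * v).re • X + (ζ * v).im • Y := by
    conv_lhs => rw [hdec v]
    rw [map_add, map_smul, map_smul]
  have hnv : diff (gaussMap f) x v = (ζ * v).re • A + (ζ * v).im • B := by
    conv_lhs => rw [hdec v]
    rw [map_add, map_smul, map_smul]
  rw [hlin, hv, hnv]
  simp only [inner_add_left, inner_add_right, real_inner_smul_left, real_inner_smul_right, hXB, hYA,
    real_inner_comm X Y, hXY, real_inner_self_eq_norm_sq X, real_inner_self_eq_norm_sq Y, hnorm]
  constructor
  · ring
  · field_simp
    ring

end Isothermic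

/-! ### Bianchi's quadrilateral -/

section Darboux

variable {q : QuadraticDifferential M} {t : ℝ} {f fs g : M → ℍ[ℝ]}

/-- The derivative of quaternionic inversion is `v ↦ -x⁻¹ v x⁻¹`. -/
theorem hasFDerivAt_inv_quaternion {x : ℍ[ℝ]} (hx : x ≠ 0) :
    HasFDerivAt (fun y : ℍ[ℝ] => y⁻¹)
      (-ContinuousLinearMap.mulLeftRight ℝ ℍ[ℝ] x⁻¹ x⁻¹) x := hasFDerivAt_inv' hx

theorem contMDiff_inv {f : M → ℍ[ℝ]} (hf : ContMDiff 𝓘(ℝ, ℂ) 𝓘(ℝ, ℍ[ℝ]) ∞ f)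
    (h0 : ∀ p, f p ≠ 0) : ContMDiff 𝓘(ℝ, ℂ) 𝓘(ℝ, ℍ[ℝ]) ∞ fun p => (f p)⁻¹ := fun p => by
  have h : ContDiffAt ℝ ∞ (fun y : ℍ[ℝ] => y⁻¹) (f p) := by
    simpa only [Ring.inverse_eq_inv'] using! contDiffAt_ringInverse ℝ (Units.mk0 (f p) (h0 p))
  exact ContMDiffAt.comp p h.contMDiffAt (hf p)

/-- `df̂ = t R df* R = -t R df* R̄` for the imaginary quaternion `R = f̂ - f`. -/
theorem IsDarbouxTransform.diff_eq_star (hC : IsChristoffelDual q f fs)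
    (hD : IsDarbouxTransform q t f g) (p : M) (v : ℂ) :
    diff g p v = (-t) • ((g p - f p) * diff fs p v * star (g p - f p)) := by
  have hR : (g p - f p).re = 0 := by simp [hD.1.imaginary, hD.2.1.imaginary]
  rw [hD.2.2.2, hC.diff_eq, star_eq_neg_of_re_eq_zero hR, mul_neg, smul_neg, neg_smul, neg_neg]

theorem IsDarbouxTransform.isConformalSurface (hC : IsChristoffelDual q f fs)
    (hD : IsDarbouxTransform q t f g) : IsConformalSurface g :=
  hC.isConformalSurface.of_diff_eq hD.2.1 fun p => ⟨_, _, hD.diff_eq_star hC p⟩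

/-- The dual form of a Darboux transform is `(1/t) R⁻¹ df R⁻¹`, the differential of Bianchi's
completion. -/
theorem IsDarbouxTransform.dualForm_eq (hC : IsChristoffelDual q f fs)
    (hD : IsDarbouxTransform q t f g) (p : M) (v : ℂ) :
    dualForm q g p v = t⁻¹ • ((g p - f p)⁻¹ * diff f p v * (g p - f p)⁻¹) := by
  have hR : (g p - f p).re = 0 := by simp [hD.1.imaginary, hD.2.1.imaginary]
  rw [hC.isConformalSurface.dualForm_of_diff_eq hD.2.1 (sub_ne_zero.2 (hD.2.2.1 p))
    (hD.diff_eq_star hC p), ← hC.symm.diff_eq, star_eq_neg_of_re_eq_zero hR, inv_neg, inv_neg]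
  simp

/-- In `df̂* = df* - (1/t) R⁻¹ (df̂ - df) R⁻¹` the Riccati equation `df̂ = t R df* R` cancels `df*`. -/
theorem diff_bianchi (hC : IsChristoffelDual q f fs) (hD : IsDarbouxTransform q t f g)
    (ht : t ≠ 0) (p : M) (v : ℂ) :
    diff (bianchi t f fs g) p v = t⁻¹ • ((g p - f p)⁻¹ * diff f p v * (g p - f p)⁻¹) := by
  have hR := sub_ne_zero.2 (hD.2.2.1 p)
  have h1 := (hD.2.1.hasMFDerivAt p).sub (hD.1.hasMFDerivAt p)
  have h2 := (hasMFDerivAt_comp_of_hasFDerivAt h1 (hasFDerivAt_inv_quaternion hR)).const_smul (1 / t)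
  have h3 := ((hC.2.1.hasMFDerivAt p).add h2).mfderiv
  have h4 := congrArg (fun A : ℂ →L[ℝ] ℍ[ℝ] => A v) h3
  have h5 : diff (bianchi t f fs g) p v = diff fs p v + (1 / t) •
    -((g p - f p)⁻¹ * (diff g p v - diff f p v) * (g p - f p)⁻¹) := h4
  rw [h5, hD.2.2.2, ← hC.diff_eq, mul_sub, sub_mul, mul_smul_comm, smul_mul_assoc,
    mul_assoc _ _ (g p - f p), inv_mul_cancel_left₀ hR, mul_assoc, mul_inv_cancel₀ hR, mul_one, neg_sub, smul_sub, smul_smul,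
    one_div, inv_mul_cancel₀ ht]
  simp

theorem isSurface_bianchi (hC : IsChristoffelDual q f fs) (hD : IsDarbouxTransform q t f g)
    (ht : t ≠ 0) : IsSurface (bianchi t f fs g) where
  smooth := by
    have h : ContDiff ℝ ∞ fun z : ℍ[ℝ] => (1 / t) • z := by fun_prop
    exact hC.2.1.smooth.add (h.contMDiff.comp
      (contMDiff_inv (hD.2.1.smooth.sub hD.1.smooth) fun p => sub_ne_zero.2 (hD.2.2.1 p)))
  imaginary p := by
    have hR : (g p - f p).re = 0 := by simp [hD.1.imaginary, hD.2.1.imaginary]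
    simp [bianchi, hC.2.1.imaginary, re_inv_of_re_eq_zero hR]
  immersion p := by
    refine (injective_iff_map_eq_zero _).2 fun v hv => ?_
    have hR := sub_ne_zero.2 (hD.2.2.1 p)
    rw [diff_bianchi hC hD ht] at hv
    have : diff f p v = 0 := by simpa [ht, hR] using hv
    exact hC.1.immersion p (this.trans (map_zero _).symm)

theorem IsDarbouxTransform.isChristoffelDual_bianchi (hC : IsChristoffelDual q f fs)
    (hD : IsDarbouxTransform q t f g) (ht : t ≠ 0) :
    IsChristoffelDual q g (bianchi t f fs g) :=
  (hD.isConformalSurface hC).isChristoffelDual (isSurface_bianchi hC hD ht) fun p v => by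
    rw [diff_bianchi hC hD ht, hD.dualForm_eq hC]

theorem IsDarbouxTransform.bianchi (hC : IsChristoffelDual q f fs)
    (hD : IsDarbouxTransform q t f g) (ht : t ≠ 0) :
    IsDarbouxTransform q t fs (bianchi t f fs g) := by
  have hR := fun p => sub_ne_zero.2 (hD.2.2.1 p)
  refine ⟨hC.isConformalSurface, isSurface_bianchi hC hD ht, fun p h => ?_, fun p v => ?_⟩
  · simp [Isothermic.bianchi, ht, hR p] at h
  · rw [diff_bianchi hC hD ht, ← hC.symm.diff_eq, Isothermic.bianchi, add_sub_cancel_left]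
    simp only [smul_mul_assoc, mul_smul_comm, smul_smul]
    congr 1
    field_simp

end Darboux

/-! ### Möbius transformations -/

section Moebius

/-- For a Möbius transformation preserving the imaginary quaternions, the left factor `a - μ(x) c` of
its differential at an imaginary `x` is a real multiple of the conjugate of the right factor
`(c x + d)⁻¹`. The multiple is `d̄ a + b̄ c`, which does not depend on `x`; it is real because
`Re ((a x + b) (c x + d)‾) = 0` for all imaginary `x`. -/
theorem Moebius.exists_factor (μ : Moebius) : ∃ ρ : ℝ, ∀ x : ℍ[ℝ], x.re = 0 → μ.FiniteAt x →
    μ.a - μ.apply x * μ.c = ρ • star (μ.c * x + μ.d)⁻¹ := by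
  obtain ⟨a, b, c, d, -, himag⟩ := μ
  simp only [Moebius.apply, Moebius.FiniteAt] at *
  have hP : ∀ x : ℍ[ℝ], x.re = 0 → ((a * x + b) * star (c * x + d)).re = 0 := fun x hx => by
    by_cases h : c * x + d = 0
    · simp [h]
    · have := himag x hx h
      rw [Quaternion.inv_def, mul_smul_comm, Quaternion.re_smul, smul_eq_mul, mul_eq_zero] at this
      exact this.resolve_left (inv_ne_zero (Quaternion.normSq_ne_zero.2 h))
  simp only [Quaternion.re_mul, Quaternion.re_add, Quaternion.imI_add, Quaternion.imJ_add,
    Quaternion.imK_add, Quaternion.imI_mul, Quaternion.imJ_mul, Quaternion.imK_mul,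
    Quaternion.re_star, Quaternion.imI_star, Quaternion.imJ_star, Quaternion.imK_star] at hP
  -- comparing coefficients of the quadratic polynomial `hP` in the components of `x`
  have hi := hP ⟨0, 1, 0, 0⟩ rfl
  have hi' := hP ⟨0, -1, 0, 0⟩ rfl
  have hj := hP ⟨0, 0, 1, 0⟩ rfl
  have hj' := hP ⟨0, 0, -1, 0⟩ rfl
  have hk := hP ⟨0, 0, 0, 1⟩ rfl
  have hk' := hP ⟨0, 0, 0, -1⟩ rfl
  have h0 := hP ⟨0, 0, 0, 0⟩ rfl
  simp only [mul_zero, mul_one, mul_neg] at h0 hi hi' hj hj' hk hk'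
  have hca : star c * a + star a * c = 0 := by
    ext <;> simp <;> linarith
  have hρ : star d * a + star b * c = ((star d * a + star b * c).re : ℍ[ℝ]) := by
    ext <;> simp <;> linarith
  refine ⟨(star d * a + star b * c).re, fun x hx hfin => ?_⟩
  have hs := star_eq_neg_of_re_eq_zero (himag x hx hfin)
  have hsx := star_eq_neg_of_re_eq_zero hx
  set D := c * x + d with hD
  set m := (a * x + b) * D⁻¹ with hm
  have hmD : m * D = a * x + b := by rw [hm, mul_assoc, inv_mul_cancel₀ hfin, mul_one]
  have h2 : star D * m = -star (a * x + b) := by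
    rw [← hmD, star_mul, hs, mul_neg, neg_neg]
  have hDs : star D ≠ 0 := star_ne_zero.2 hfin
  have h3 : star D * (a - m * c) = ((star d * a + star b * c).re : ℍ[ℝ]) := by
    rw [← hρ, mul_sub, ← mul_assoc, h2, hD]
    simp only [star_add, star_mul, hsx]
    calc _ = star d * a + star b * c - x * (star c * a + star a * c) := by noncomm_ring
      _ = _ := by rw [hca, mul_zero, sub_zero]
  rw [star_inv₀]
  apply mul_left_cancel₀ hDs
  rw [h3, mul_smul_comm, mul_inv_cancel₀ hDs]
  ext <;> simp

/-- A Möbius transformation acts on differences as it does on differentials (`Moebius.diff_apply`),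
with the right factor taken at the other point. -/
theorem Moebius.apply_sub_apply (μ : Moebius) {x y : ℍ[ℝ]} (hx : μ.FiniteAt x)
    (hy : μ.FiniteAt y) :
    μ.apply y - μ.apply x = (μ.a - μ.apply x * μ.c) * (y - x) * (μ.c * y + μ.d)⁻¹ := by
  have h1 : μ.apply x * (μ.c * x + μ.d) = μ.a * x + μ.b := by
    rw [Moebius.apply, mul_assoc, inv_mul_cancel₀ hx, mul_one]
  have hy' : μ.c * y + μ.d ≠ 0 := hy
  apply mul_right_cancel₀ hy'
  rw [mul_assoc _ _ (μ.c * y + μ.d), inv_mul_cancel₀ hy', mul_one, sub_mul]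
  have h2 : μ.apply y * (μ.c * y + μ.d) = μ.a * y + μ.b := by
    rw [Moebius.apply, mul_assoc, inv_mul_cancel₀ hy', mul_one]
  rw [h2]
  calc _ = μ.a * y + μ.b - μ.apply x * (μ.c * y + μ.d) +
        (μ.apply x * (μ.c * x + μ.d) - (μ.a * x + μ.b)) := by rw [h1, sub_self, add_zero]
    _ = _ := by noncomm_ring

theorem Moebius.diff_apply (μ : Moebius) {f : M → ℍ[ℝ]} (hf : IsSurface f) {p : M}
    (hfin : μ.FiniteAt (f p)) (v : ℂ) :
    diff (fun p => μ.apply (f p)) p v =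
      (μ.a - μ.apply (f p) * μ.c) * diff f p v * (μ.c * f p + μ.d)⁻¹ := by
  have hlin : ∀ a b : ℍ[ℝ], HasFDerivAt (fun x => a * x + b)
      (ContinuousLinearMap.mul ℝ ℍ[ℝ] a) (f p) := fun a b =>
    (ContinuousLinearMap.mul ℝ ℍ[ℝ] a).hasFDerivAt.add_const b
  have h1 := (hlin μ.a μ.b).mul' ((hasFDerivAt_inv_quaternion hfin).comp (f p) (hlin μ.c μ.d))
  have h2 := (hasMFDerivAt_comp_of_hasFDerivAt (hf.hasMFDerivAt p) h1).mfderiv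
  have h3 := congrArg (fun A : ℂ →L[ℝ] ℍ[ℝ] => A v) h2
  have h4 : diff (fun p => μ.apply (f p)) p v =
    (μ.a * f p + μ.b) * -((μ.c * f p + μ.d)⁻¹ * (μ.c * diff f p v) * (μ.c * f p + μ.d)⁻¹) +
      μ.a * diff f p v * (μ.c * f p + μ.d)⁻¹ := h3
  rw [h4, Moebius.apply]
  noncomm_ring

/-- With `B_x = (c x + d)⁻¹` and the same real `ρ` at all points, `d(μ ∘ f) = ρ B̄_f df B_f` and
`μ(y) - μ(x) = ρ B̄_x (y - x) B_y`. -/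
theorem Moebius.exists_real_factor (μ : Moebius) : ∃ ρ : ℝ,
    (∀ {f : M → ℍ[ℝ]}, IsSurface f → ∀ {p : M}, μ.FiniteAt (f p) → ∀ v,
      diff (fun p => μ.apply (f p)) p v =
        ρ • (star (μ.c * f p + μ.d)⁻¹ * diff f p v * (μ.c * f p + μ.d)⁻¹)) ∧
    ∀ {x y : ℍ[ℝ]}, x.re = 0 → μ.FiniteAt x → μ.FiniteAt y →
      μ.apply y - μ.apply x = ρ • (star (μ.c * x + μ.d)⁻¹ * (y - x) * (μ.c * y + μ.d)⁻¹) := by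
  obtain ⟨ρ, hρ⟩ := μ.exists_factor
  refine ⟨ρ, fun hf p hfin v => ?_, fun hx hfx hfy => ?_⟩
  · rw [μ.diff_apply hf hfin, hρ _ (hf.imaginary p) hfin, smul_mul_assoc, smul_mul_assoc]
  · rw [μ.apply_sub_apply hfx hfy, hρ _ hx hfx, smul_mul_assoc, smul_mul_assoc]

variable {q : QuadraticDifferential M} {t : ℝ} {x y : M → ℍ[ℝ]}

theorem IsSurface.moebius (μ : Moebius) {ρ : ℝ} (hρ : ρ ≠ 0) (hy : IsSurface y)
    (hfin : ∀ p, μ.FiniteAt (y p))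
    (hd : ∀ p v, diff (fun p => μ.apply (y p)) p v =
      ρ • (star (μ.c * y p + μ.d)⁻¹ * diff y p v * (μ.c * y p + μ.d)⁻¹)) :
    IsSurface fun p => μ.apply (y p) where
  smooth := by
    have h1 : ∀ a b : ℍ[ℝ], ContMDiff 𝓘(ℝ, ℂ) 𝓘(ℝ, ℍ[ℝ]) ∞ fun p => a * y p + b := fun a b => by
      have h : ContDiff ℝ ∞ fun z : ℍ[ℝ] => a * z + b := by fun_prop
      exact h.contMDiff.comp hy.smooth
    have h2 : ContDiff ℝ ∞ fun z : ℍ[ℝ] × ℍ[ℝ] => z.1 * z.2 := by fun_prop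
    exact h2.contMDiff.comp ((h1 μ.a μ.b).prodMk_space (contMDiff_inv (h1 μ.c μ.d) hfin))
  imaginary p := μ.maps_imaginary _ (hy.imaginary p) (hfin p)
  immersion p := by
    refine (injective_iff_map_eq_zero _).2 fun v hv => ?_
    have h0 : (μ.c * y p + μ.d)⁻¹ ≠ 0 := inv_ne_zero (hfin p)
    rw [hd] at hv
    have : diff y p v = 0 := by
      simpa only [smul_eq_zero, mul_eq_zero, star_eq_zero, hρ, h0, false_or, or_false] using hv
    exact hy.immersion p (this.trans (map_zero _).symm)

/-- Darboux transforms are Möbius invariant. The dual form of `μ ∘ x` is `ρ⁻¹ B_x⁻¹ dx* B̄_x⁻¹`, and the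
two factorizations of `μ(y) - μ(x)` cancel the factors `B_x` around it. -/
theorem IsDarbouxTransform.moebius (μ : Moebius) (h : IsDarbouxTransform q t x y)
    (hx : ∀ p, μ.FiniteAt (x p)) (hy : ∀ p, μ.FiniteAt (y p))
    (hm : IsConformalSurface fun p => μ.apply (x p)) :
    IsDarbouxTransform q t (fun p => μ.apply (x p)) (fun p => μ.apply (y p)) := by
  by_cases hM : IsEmpty M
  · exact ⟨hm, ⟨fun p => hM.elim p, fun p => hM.elim p, fun p => hM.elim p⟩, fun p => hM.elim p,
      fun p => hM.elim p⟩
  obtain ⟨p₀⟩ := not_isEmpty_iff.1 hM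
  obtain ⟨ρ, hd, hs⟩ := μ.exists_real_factor (M := M)
  -- `ρ = 0` would make `μ ∘ x` constant, contradicting that it is immersed
  have hρ : ρ ≠ 0 := fun h0 => hm.diff_ne_zero p₀ one_ne_zero (by
    rw [hd h.1.toIsSurface (hx p₀), h0, zero_smul])
  have hxy := fun p => sub_ne_zero.2 (h.2.2.1 p)
  refine ⟨hm, h.2.1.moebius μ hρ hy fun p v => hd h.2.1 (hy p) v, fun p h0 => ?_, fun p v => ?_⟩
  · have h1 : (μ.c * x p + μ.d)⁻¹ ≠ 0 := inv_ne_zero (hx p)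
    have h2 : (μ.c * y p + μ.d)⁻¹ ≠ 0 := inv_ne_zero (hy p)
    have h3 := hs (h.1.imaginary p) (hx p) (hy p)
    rw [sub_eq_zero.2 h0, eq_comm] at h3
    simp only [smul_eq_zero, mul_eq_zero, star_eq_zero, hρ, h1, h2, hxy p, or_self] at h3
  · have h1 : (μ.c * x p + μ.d)⁻¹ ≠ 0 := inv_ne_zero (hx p)
    have h1' : star (μ.c * x p + μ.d)⁻¹ ≠ 0 := star_ne_zero.2 h1
    have hdual := h.1.dualForm_of_diff_eq (q := q) hm.toIsSurface (p := p) (κ := ρ)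
      (S := star (μ.c * x p + μ.d)⁻¹) h1' (fun v => by
        rw [hd h.1.toIsSurface (hx p), star_star]) v
    -- exchanging the roles of the two points gives a second factorization of the difference
    have hl : μ.apply (y p) - μ.apply (x p) =
        ρ • (star (μ.c * y p + μ.d)⁻¹ * (y p - x p) * (μ.c * x p + μ.d)⁻¹) := by
      rw [← neg_sub, hs (h.2.1.imaginary p) (hy p) (hx p), ← neg_sub (y p), mul_neg, neg_mul, smul_neg,
        neg_neg]
    have hr := hs (h.1.imaginary p) (hx p) (hy p)
    rw [hdual, hd h.2.1 (hy p), h.2.2.2, star_star,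
      congrArg₂ (fun a b => a * (ρ⁻¹ • ((μ.c * x p + μ.d)⁻¹⁻¹ * dualForm q x p v *
        (star (μ.c * x p + μ.d)⁻¹)⁻¹)) * b) hl hr]
    simp only [smul_mul_assoc, mul_smul_comm, smul_smul, mul_assoc, mul_inv_cancel_left₀ h1,
      inv_mul_cancel_left₀ h1']
    congr 1
    field_simp

end Moebius

end Isothermic

theorem theorem1 {M : Type*} [TopologicalSpace M] [ChartedSpace ℂ M] [IsManifold 𝓘(ℂ, ℂ) ω M]
    (q : Isothermic.QuadraticDifferential M) (t : ℝ) (ht : t ≠ 0) (μ : Isothermic.Moebius)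
    (f fstar fhat ftilde : M → ℍ[ℝ])
    (hf : Isothermic.IsIsothermic q f)
    (hhat : Isothermic.IsDarbouxTransform q t f fhat)
    (htilde : Isothermic.IsGoursatTransformVia q μ f fstar ftilde)
    (hfin : ∀ p, μ.FiniteAt (Isothermic.bianchi t f fstar fhat p)) :
    let fhatstar : M → ℍ[ℝ] := Isothermic.bianchi t f fstar fhat
    let m : M → ℍ[ℝ] := fun p => μ.apply (fstar p)
    let mhat : M → ℍ[ℝ] := fun p => μ.apply (fhatstar p)
    let G : M → ℍ[ℝ] := fun p => ftilde p + (1 / t) • (mhat p - m p)⁻¹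
    -- `G` is a Goursat transform of `fhat` and a Darboux transform of `ftilde`
    (Isothermic.IsGoursatTransform q μ fhat G ∧ Isothermic.IsDarbouxTransform q t ftilde G) ∧
    -- all surfaces of the diagram are isothermic, with common curvature line net `q`
    (Isothermic.IsIsothermic q fstar ∧ Isothermic.IsIsothermic q m ∧
      Isothermic.IsIsothermic q ftilde ∧ Isothermic.IsIsothermic q fhat ∧
      Isothermic.IsIsothermic q fhatstar ∧ Isothermic.IsIsothermic q mhat ∧
      Isothermic.IsIsothermic q G) ∧
    -- the Christoffel edges, in both directions
    (Isothermic.IsChristoffelDual q f fstar ∧ Isothermic.IsChristoffelDual q fstar f ∧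
      Isothermic.IsChristoffelDual q fhat fhatstar ∧
      Isothermic.IsChristoffelDual q fhatstar fhat ∧
      Isothermic.IsChristoffelDual q m ftilde ∧ Isothermic.IsChristoffelDual q ftilde m ∧
      Isothermic.IsChristoffelDual q mhat G ∧ Isothermic.IsChristoffelDual q G mhat) ∧
    -- the Darboux edges
    (Isothermic.IsDarbouxTransform q t f fhat ∧
      Isothermic.IsDarbouxTransform q t fstar fhatstar ∧
      Isothermic.IsDarbouxTransform q t m mhat ∧
      Isothermic.IsDarbouxTransform q t ftilde G) ∧
    -- the Goursat edges, factoring through the Möbius edges `fstar → m` and `fhatstar → mhat`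
    (Isothermic.IsGoursatTransformVia q μ f fstar ftilde ∧
      Isothermic.IsGoursatTransformVia q μ fhat fhatstar G) := by
  open Isothermic in
  intro fhatstar m mhat G
  -- only the local coordinates with `q = dw²` are needed from the hypothesis on `f`
  have hw : ∀ p, ∃ w : M → ℂ, ∀ᶠ x in 𝓝 p, MDifferentiableAt 𝓘(ℂ, ℂ) 𝓘(ℂ, ℂ) w x ∧
      ∀ v : ℂ, q x v = cdiff w x v ^ 2 := fun p =>
    (hf.2 p).imp fun w h => h.mono fun x hx => ⟨hx.1, hx.2.1⟩
  obtain ⟨hC, hfinx, hCm⟩ := id htilde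
  have hC1 : IsChristoffelDual q fhat fhatstar := hhat.isChristoffelDual_bianchi hC ht
  have hDs : IsDarbouxTransform q t fstar fhatstar := hhat.bianchi hC ht
  have hDm : IsDarbouxTransform q t m mhat := hDs.moebius μ hfinx hfin hCm.1
  have hC2 : IsChristoffelDual q mhat G := hDm.isChristoffelDual_bianchi hCm ht
  have hDG : IsDarbouxTransform q t ftilde G := hDm.bianchi hCm ht
  have hG : IsGoursatTransformVia q μ fhat fhatstar G := ⟨hC1, hfin, hC2⟩
  exact ⟨⟨⟨fhatstar, hG⟩, hDG⟩,
    ⟨hC.symm.isIsothermic hw, hCm.isIsothermic hw, hCm.symm.isIsothermic hw, hC1.isIsothermic hw,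
      hC1.symm.isIsothermic hw, hC2.isIsothermic hw, hC2.symm.isIsothermic hw⟩,
    ⟨hC, hC.symm, hC1, hC1.symm, hCm, hCm.symm, hC2, hC2.symm⟩, ⟨hhat, hDs, hDm, hDG⟩, htilde, hG⟩
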